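/- All graphs are finite and simple. A \emph{linear embedding} of a graph $G=(V,E)$ is a pair $(\prec,\mathcal P)$, where $\prec$ is a total ordering of $V$ and $\mathcal P$ is a partition of $E$ into nonempty parts, called pages. Edges $uv$ and $xy$ \emph{cross} if $u\prec x\prec v\prec y$; a set of edges is \emph{crossing-free} if no two of its edges cross. A \emph{book embedding} is a linear embedding all of whose pages are crossing-free; a \emph{union embedding} is a linear embedding such that for every page $P$ and every connected component $C$ of the graph formed by the edges in $P$, the edge set of $C$ is crossing-free. The \emph{page number} $\operatorname{pn}(G)$ (respectively the \emph{union page number} $\operatorname{pn}_u(G)$) is the smallest $|\mathcal P|$ over all book embeddings (respectively union embeddings) of $G$. The \emph{local page number} $\operatorname{pn}_\ell(G)$ is the smallest $k$ such that $G$ has a book embedding, with any number of pages, in which every vertex has incident edges on at most $k$ pages. Theorem. There is an absolute constant $c>0$ such that for every integer $k\ge 3$ there are infinitely many $n$ for which there exists a $k$-regular graph $G$ on $n$ vertices with $$\operatorname{pn}_\ell(G)\le \operatorname{pn}_u(G)\le k+2\qquad\text{and}\qquad \operatorname{pn}(G)\ge c\,\sqrt{k}\,n^{1/2-1/k}.$$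 In contrast, every graph $G$ satisfies $\operatorname{pn}_u(G)\le 4\operatorname{pn}_\ell(G)+2$. -/

import Mathlib

namespace BookEmbedding

variable {V : Type*}

/-- A linear embedding of a graph `G`: a total ordering of the vertices (the spine ordering)
together with a partition of the edge set into nonempty parts (the pages). -/
structure LinearEmbedding (G : SimpleGraph V) where
  /-- the spine ordering -/
  spine : LinearOrder V
  /-- the pages -/
  pages : Set (Set (Sym2 V))
  empty_notMem : ∅ ∉ pages
  disjoint : pages.PairwiseDisjoint id
  sUnion_eq : ⋃₀ pages = G.edgeSet

/-- A set `P` of edges is crossing-free for a given spine ordering if it does not contain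
two edges `uv` and `xy` with `u ≺ x ≺ v ≺ y`. -/
def CrossingFree (ord : LinearOrder V) (P : Set (Sym2 V)) : Prop :=
  ∀ u x v y : V, ord.lt u x → ord.lt x v → ord.lt v y → s(u, v) ∈ P → s(x, y) ∉ P

/-- The edge set `E(C)` of a connected component `C` of the graph formed by the edges in `P`.
(Vertices of `V` without an incident edge in `P` are components without edges.) -/
def componentEdges (P : Set (Sym2 V)) (C : (SimpleGraph.fromEdgeSet P).ConnectedComponent) :
    Set (Sym2 V) :=
  {e | e ∈ P ∧ ∀ v ∈ e, v ∈ C.supp}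

namespace LinearEmbedding

variable {G : SimpleGraph V}

/-- A book embedding: every page is crossing-free. -/
def IsBook (L : LinearEmbedding G) : Prop :=
  ∀ P ∈ L.pages, CrossingFree L.spine P

/-- The set of pages that contain at least one edge incident to `v`. -/
def pagesAt (L : LinearEmbedding G) (v : V) : Set (Set (Sym2 V)) :=
  {P | P ∈ L.pages ∧ ∃ e ∈ P, v ∈ e}

/-- A `k`-local book embedding: every vertex has incident edges on at most `k` pages. -/
def IsLocalBook (L : LinearEmbedding G) (k : ℕ) : Prop :=
  L.IsBook ∧ ∀ v : V, (L.pagesAt v).encard ≤ k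

/-- A union embedding: every connected component of every page is crossing-free. -/
def IsUnion (L : LinearEmbedding G) : Prop :=
  ∀ P ∈ L.pages, ∀ C : (SimpleGraph.fromEdgeSet P).ConnectedComponent,
    CrossingFree L.spine (componentEdges P C)

end LinearEmbedding

/-- The page number: the smallest `k` for which there is a `k`-page book embedding.
For finite graphs there always is one, see `exists_isBook`. -/
noncomputable def pageNumber (G : SimpleGraph V) : ℕ :=
  sInf {k : ℕ | ∃ L : LinearEmbedding G, L.IsBook ∧ L.pages.encard = k}

/-- The local page number: the smallest `k` for which there is a `k`-local book embedding. -/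
noncomputable def localPageNumber (G : SimpleGraph V) : ℕ :=
  sInf {k : ℕ | ∃ L : LinearEmbedding G, L.IsLocalBook k}

/-- The union page number: the smallest `k` for which there is a `k`-page union embedding. -/
noncomputable def unionPageNumber (G : SimpleGraph V) : ℕ :=
  sInf {k : ℕ | ∃ L : LinearEmbedding G, L.IsUnion ∧ L.pages.encard = k}

/-- Every finite graph has a book embedding with finitely many pages (one page per edge), and
it is `k`-local and a union embedding, so that the three infima above are minima of nonempty
sets. -/
theorem exists_isBook [Finite V] (G : SimpleGraph V) :
    ∃ (L : LinearEmbedding G) (k : ℕ), L.pages.encard = k ∧ L.IsLocalBook k ∧ L.IsUnion := by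
  classical
  let ord : LinearOrder V := IsWellOrder.linearOrder WellOrderingRel
  let L : LinearEmbedding G :=
    { spine := ord
      pages := (fun e => ({e} : Set (Sym2 V))) '' G.edgeSet
      empty_notMem := by rintro ⟨e, -, h⟩; exact Set.singleton_ne_empty e h
      disjoint := by
        rintro _ ⟨e, -, rfl⟩ _ ⟨f, -, rfl⟩ hne
        have hef : e ≠ f := fun h => hne (by rw [h])
        simpa [Function.onFun] using hef
      sUnion_eq := by ext e; simp }
  have hcf : ∀ (e : Sym2 V) (Q : Set (Sym2 V)), Q ⊆ {e} → CrossingFree ord Q := by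
    intro e Q hQ u x v y hux hxv hvy h1 h2
    have h3 : s(u, v) = s(x, y) := (hQ h1).trans (hQ h2).symm
    rcases Sym2.eq_iff.1 h3 with ⟨h, -⟩ | ⟨h, -⟩
    · exact (@ne_of_lt V ord.toPreorder _ _ hux) h
    · exact (@ne_of_lt V ord.toPreorder _ _
        (@lt_trans V ord.toPreorder _ _ _ (@lt_trans V ord.toPreorder _ _ _ hux hxv) hvy)) h
  have hbook : L.IsBook := by
    rintro _ ⟨e, -, rfl⟩
    exact hcf e _ subset_rfl
  have hcard : L.pages.encard = (L.pages.ncard : ℕ) :=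
    (Set.Finite.cast_ncard_eq (Set.toFinite _)).symm
  refine ⟨L, L.pages.ncard, hcard, ⟨hbook, fun v => ?_⟩, ?_⟩
  · rw [← hcard]
    exact Set.encard_le_encard fun P hP => hP.1
  · rintro _ ⟨e, -, rfl⟩ C
    exact hcf e _ fun f hf => hf.1

end BookEmbedding

namespace BookEmbedding

/-! Two mechanisms carry the proof: star forests bound `unionPageNumber` from above, and counting
bounds `pageNumber` from below.

Edges covered by `k` star forests give a `k`-page union embedding in any spine order, since edges of
a star share an endpoint. In a noncrossing page every edge is the longest arc going right from its
left end or left from its right end. A vertex meets at most `localPageNumber` pages, so twice that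
many maps, each pointing only right or only left, cover all edges. Each map is a forest and splits
by parity into two star forests, whence the factor 4. Conversely, the components of a union
embedding serve as pages of a local book embedding.

For the lower bound take `m`-fold lifts of `K_{k,k}`. They are `k`-regular and are unions of `k`
star forests. If all have at most `p` pages, cut each spine into `s` blocks: only O(`p * s`) pairs
of blocks are joined. The block assignment and the set of joined pairs allow few lifts, by AM-GM,
while there are `m! ^ (k ^ 2)` lifts in all. Comparing the two counts bounds `p` from below. -/

/-! ### Longest arcs and star forests -/

/-- The edges of a noncrossing family of arcs are covered by the longest arc to the right and the
longest arc to the left of every point. -/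
theorem exists_longest_arcs {α : Type*} [Finite α] [LinearOrder α] (T : α → α → Prop)
    (hlt : ∀ i j, T i j → i < j)
    (hT : ∀ i j i' j', T i j → T i' j' → i < i' → i' < j → ¬ j < j') :
    ∃ R L : α → α, (∀ i, i ≤ R i) ∧ (∀ i, L i ≤ i) ∧ ∀ i j, T i j → R i = j ∨ L j = i := by
  have hR : ∀ i, ∃ w, i ≤ w ∧ ∀ j, T i j → T i w ∧ j ≤ w := by
    intro i
    by_cases h : ∃ j, T i j
    · obtain ⟨w, hw, hmax⟩ := Set.exists_max_image {j | T i j} id (Set.toFinite _) h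
      exact ⟨w, (hlt _ _ hw).le, fun j hj => ⟨hw, hmax j hj⟩⟩
    · exact ⟨i, le_rfl, fun j hj => (h ⟨j, hj⟩).elim⟩
  have hL : ∀ j, ∃ w, w ≤ j ∧ ∀ i, T i j → T w j ∧ w ≤ i := by
    intro j
    by_cases h : ∃ i, T i j
    · obtain ⟨w, hw, hmin⟩ := Set.exists_min_image {i | T i j} id (Set.toFinite _) h
      exact ⟨w, (hlt _ _ hw).le, fun i hi => ⟨hw, hmin i hi⟩⟩
    · exact ⟨j, le_rfl, fun i hi => (h ⟨i, hi⟩).elim⟩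
  choose R hR1 hR2 using hR
  choose L hL1 hL2 using hL
  refine ⟨R, L, hR1, hL1, fun i j hij => ?_⟩
  by_contra! hne
  obtain ⟨hr, hr'⟩ := hR2 i j hij
  obtain ⟨hl, hl'⟩ := hL2 j i hij
  -- If both failed, the longest arc into `j` and the longest arc out of `i` would cross.
  exact hT _ _ _ _ hl hr (lt_of_le_of_ne hl' hne.2) (hlt _ _ hij)
    (lt_of_le_of_ne hr' hne.1.symm)

/-- A set of edges covered by the stars of an idempotent map has crossing-free components. -/
theorem crossingFree_componentEdges_of_stars {V : Type*} (ord : LinearOrder V)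
    {P : Set (Sym2 V)} (h : V → V)
    (hP : ∀ e ∈ P, ∃ v, e = s(v, h v) ∧ h (h v) = h v)
    (C : (SimpleGraph.fromEdgeSet P).ConnectedComponent) :
    CrossingFree ord (componentEdges P C) := by
  have hadj : ∀ u v, s(u, v) ∈ P → h u = h v ∧ (h u = u ∨ h u = v) := by
    intro u v huv
    obtain ⟨w, hw, hw'⟩ := hP _ huv
    rcases Sym2.eq_iff.1 hw with ⟨rfl, rfl⟩ | ⟨rfl, rfl⟩
    · exact ⟨hw'.symm, Or.inr rfl⟩
    · exact ⟨hw', Or.inl hw'⟩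
  have hreach : ∀ u v, (SimpleGraph.fromEdgeSet P).Reachable u v → h u = h v := by
    rintro u v ⟨p⟩
    induction p with
    | nil => rfl
    | cons hab _ ih => exact (hadj _ _ ((SimpleGraph.fromEdgeSet_adj P).1 hab).1).1.trans ih
  rintro u x v y hux hxv hvy ⟨h1, h1C⟩ ⟨h2, h2C⟩
  have hu : u ∈ C.supp := h1C u (Sym2.mem_mk_left u v)
  have hx : x ∈ C.supp := h2C x (Sym2.mem_mk_left x y)
  have hux' : h u = h x := hreach u x (SimpleGraph.ConnectedComponent.exact (hu.trans hx.symm))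
  obtain ⟨-, h3⟩ := hadj _ _ h1
  obtain ⟨-, h4⟩ := hadj _ _ h2
  let := ord
  have a1 : u < x := hux
  have a2 : x < v := hxv
  have a3 : v < y := hvy
  -- Both edges contain the common centre `h u`, yet crossing edges have four distinct ends.
  rw [← hux'] at h4
  rcases h3 with h3 | h3 <;> rcases h4 with h4 | h4 <;> rw [h3] at h4 <;> subst h4
  · exact lt_irrefl _ a1
  · exact lt_irrefl _ (a1.trans (a2.trans a3))
  · exact lt_irrefl _ a2
  · exact lt_irrefl _ a3

/-- An idempotent value `h i (h i v) = h i v` makes `h i v` the centre of a star, so each index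
yields one page; assigning every edge a single index makes the pages disjoint. -/
theorem unionPageNumber_le_card_stars {V : Type*} (G : SimpleGraph V) {ι : Type*} [Fintype ι]
    (h : ι → V → V)
    (hG : ∀ e ∈ G.edgeSet, ∃ i v, e = s(v, h i v) ∧ h i (h i v) = h i v) :
    unionPageNumber G ≤ Fintype.card ι := by
  classical
  let ord : LinearOrder V := IsWellOrder.linearOrder WellOrderingRel
  choose f hf using hG
  let page : ι → Set (Sym2 V) := fun i => {e | ∃ he : e ∈ G.edgeSet, f e he = i}
  let L : LinearEmbedding G :=
    { spine := ord
      pages := Set.range page \ {∅}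
      empty_notMem := fun h => h.2 rfl
      disjoint := by
        rintro _ ⟨⟨i, rfl⟩, -⟩ _ ⟨⟨j, rfl⟩, -⟩ hne
        refine Set.disjoint_left.2 ?_
        rintro e ⟨he, rfl⟩ ⟨he', rfl⟩
        exact hne rfl
      sUnion_eq := by
        ext e
        constructor
        · rintro ⟨_, ⟨⟨i, rfl⟩, -⟩, he, -⟩
          exact he
        · intro he
          have hmem : e ∈ page (f e he) := ⟨he, rfl⟩
          exact ⟨_, ⟨⟨f e he, rfl⟩, fun h0 => by
            rw [Set.mem_singleton_iff.1 h0] at hmem; exact hmem⟩, hmem⟩ }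
  have hfin : L.pages.Finite := (Set.finite_range page).subset Set.sdiff_subset
  have hle : L.pages.ncard ≤ Fintype.card ι := by
    calc L.pages.ncard ≤ (Set.range page).ncard :=
          Set.ncard_le_ncard Set.sdiff_subset (Set.finite_range page)
      _ ≤ Fintype.card ι := by
          rw [← Set.image_univ, ← Nat.card_eq_fintype_card, ← Set.ncard_univ]
          exact Set.ncard_image_le
  refine le_trans (Nat.sInf_le ⟨L, ?_, (Set.Finite.cast_ncard_eq hfin).symm⟩) hle
  rintro _ ⟨⟨i, rfl⟩, -⟩ C
  refine crossingFree_componentEdges_of_stars ord (h i) ?_ C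
  rintro e ⟨he, rfl⟩
  exact hf e he

/-! ### Local versus union page number -/

theorem exists_isUnion_pages_encard {V : Type*} [Finite V] (G : SimpleGraph V) :
    ∃ L : LinearEmbedding G, L.IsUnion ∧ L.pages.encard = unionPageNumber G := by
  obtain ⟨L, k, hk, -, hL⟩ := exists_isBook G
  exact Nat.sInf_mem (s := {k : ℕ | ∃ L : LinearEmbedding G, L.IsUnion ∧ L.pages.encard = k})
    ⟨k, L, hL, hk⟩

theorem exists_isBook_pages_encard {V : Type*} [Finite V] (G : SimpleGraph V) :
    ∃ L : LinearEmbedding G, L.IsBook ∧ L.pages.encard = pageNumber G := by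
  obtain ⟨L, k, hk, hL, -⟩ := exists_isBook G
  exact Nat.sInf_mem (s := {k : ℕ | ∃ L : LinearEmbedding G, L.IsBook ∧ L.pages.encard = k})
    ⟨k, L, hL.1, hk⟩

theorem exists_isLocalBook_localPageNumber {V : Type*} [Finite V] (G : SimpleGraph V) :
    ∃ L : LinearEmbedding G, L.IsLocalBook (localPageNumber G) := by
  obtain ⟨L, k, -, hL, -⟩ := exists_isBook G
  exact Nat.sInf_mem (s := {k : ℕ | ∃ L : LinearEmbedding G, L.IsLocalBook k}) ⟨k, L, hL⟩

/-- Splitting the pages of a union embedding into their components gives a local book embedding. -/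
theorem localPageNumber_le_unionPageNumber {V : Type*} [Finite V] (G : SimpleGraph V) :
    localPageNumber G ≤ unionPageNumber G := by
  obtain ⟨L, hL, hcard⟩ := exists_isUnion_pages_encard G
  let L' : LinearEmbedding G :=
    { spine := L.spine
      pages := {S | S.Nonempty ∧ ∃ P ∈ L.pages, ∃ C, S = componentEdges P C}
      empty_notMem := fun h => Set.not_nonempty_empty h.1
      disjoint := by
        rintro _ ⟨-, P, hP, C, rfl⟩ _ ⟨-, P', hP', C', rfl⟩ hne
        refine Set.disjoint_left.2 ?_
        rintro e ⟨heP, heC⟩ ⟨heP', heC'⟩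
        obtain rfl : P = P' := by
          by_contra hPP
          exact Set.disjoint_left.1 (L.disjoint hP hP' hPP) heP heP'
        induction e with | _ u v =>
        have h1 : _ = C := heC u (Sym2.mem_mk_left u v)
        have h2 : _ = C' := heC' u (Sym2.mem_mk_left u v)
        exact hne (by rw [← h1, ← h2])
      sUnion_eq := by
        rw [← L.sUnion_eq]
        ext e
        constructor
        · rintro ⟨_, ⟨-, P, hP, C, rfl⟩, he⟩
          exact ⟨P, hP, he.1⟩
        · rintro ⟨P, hP, he⟩
          induction e with | _ u v =>
          have hG : G.Adj u v := by
            rw [← SimpleGraph.mem_edgeSet, ← L.sUnion_eq]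
            exact ⟨P, hP, he⟩
          have hadj : (SimpleGraph.fromEdgeSet P).Adj u v :=
            (SimpleGraph.fromEdgeSet_adj P).2 ⟨he, hG.ne⟩
          have hmem : s(u, v) ∈ componentEdges P
              ((SimpleGraph.fromEdgeSet P).connectedComponentMk u) := by
            refine ⟨he, fun w hw => ?_⟩
            rcases Sym2.mem_iff.1 hw with rfl | rfl
            · rfl
            · exact SimpleGraph.ConnectedComponent.sound hadj.reachable.symm
          exact ⟨_, ⟨⟨_, hmem⟩, P, hP, _, rfl⟩, hmem⟩ }
  refine Nat.sInf_le ⟨L', ?_, fun v => ?_⟩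
  · rintro _ ⟨-, P, hP, C, rfl⟩
    exact hL P hP C
  · rw [← hcard]
    refine le_trans (Set.encard_le_encard ?_) (Set.encard_image_le
      (fun P => componentEdges P ((SimpleGraph.fromEdgeSet P).connectedComponentMk v)) L.pages)
    rintro _ ⟨⟨-, P, hP, C, rfl⟩, e, he, hve⟩
    refine ⟨P, hP, ?_⟩
    have : _ = C := he.2 v hve
    simp only [this]

/-- The arrows `v → g v` strictly descend along `r`, so they form a forest, which is 2-coloured by
recursion. -/
theorem exists_parity {V : Type*} {r : V → V → Prop} (hr : WellFounded r) (g : V → V)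
    (hg : ∀ v, g v ≠ v → r (g v) v) :
    ∃ par : V → Bool, ∀ v, g v ≠ v → par (g v) = !par v := by
  classical
  let F : ∀ v, (∀ w, r w v → Bool) → Bool := fun v ih =>
    if h : g v ≠ v then !(ih (g v) (hg v h)) else true
  refine ⟨hr.fix F, fun v hv => ?_⟩
  rw [hr.fix_eq F v]
  simp [F, hv]

theorem exists_enumeration {α : Type*} [Nonempty α] {S : Set α} {k : ℕ} (h : S.encard ≤ k) :
    ∃ f : Fin k → α, S ⊆ Set.range f := by
  classical
  have hfin : S.Finite := Set.finite_of_encard_le_coe h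
  have hc : hfin.toFinset.card ≤ k := by
    rw [hfin.encard_eq_coe_toFinset_card] at h
    exact_mod_cast h
  -- Unused indices take an arbitrary default value.
  refine ⟨fun i => hfin.toFinset.toList.getD i (Classical.arbitrary α), fun a ha => ?_⟩
  have ha' : a ∈ hfin.toFinset.toList := by simpa using ha
  obtain ⟨i, hi, rfl⟩ := List.mem_iff_getElem.1 ha'
  have hik : i < k := lt_of_lt_of_le (by simpa using hi) hc
  exact ⟨⟨i, hik⟩, by simp only; rw [List.getD_eq_getElem _ _ hi]⟩

theorem unionPageNumber_le_four_mul {V : Type*} [Finite V] (G : SimpleGraph V) :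
    unionPageNumber G ≤ 4 * localPageNumber G := by
  classical
  obtain ⟨L, hbook, hloc⟩ := exists_isLocalBook_localPageNumber G
  set k := localPageNumber G
  let := L.spine
  choose page hpage using fun v => exists_enumeration (hloc v)
  have harcs : ∀ P : Set (Sym2 V), ∃ R L' : V → V, (∀ i, i ≤ R i) ∧ (∀ i, L' i ≤ i) ∧
      (P ∈ L.pages → ∀ i j, i < j → s(i, j) ∈ P → R i = j ∨ L' j = i) := by
    intro P
    by_cases hP : P ∈ L.pages
    · obtain ⟨R, L', h1, h2, h3⟩ := exists_longest_arcs (fun i j : V => i < j ∧ s(i, j) ∈ P)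
        (fun i j h => h.1)
        (fun i j i' j' h h' h1 h2 h3 => hbook P hP i i' j j' h1 h2 h3 h.2 h'.2)
      exact ⟨R, L', h1, h2, fun _ i j h h' => h3 i j ⟨h, h'⟩⟩
    · exact ⟨id, id, fun _ => le_rfl, fun _ => le_rfl, fun h => (hP h).elim⟩
  choose R L' hR hL' harc using harcs
  -- A slot may name different pages at different vertices; it only matters that each `g j` points
  -- in one direction along the spine.
  let g : Fin k × Bool → V → V := fun j v => if j.2 then R (page v j.1) v else L' (page v j.1) v
  have hpar : ∀ j, ∃ par : V → Bool, ∀ v, g j v ≠ v → par (g j v) = !par v := by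
    rintro ⟨j, b⟩
    cases b
    · exact exists_parity (wellFounded_lt (α := V)) _
        fun v hv => lt_of_le_of_ne (hL' _ _) hv
    · exact exists_parity (wellFounded_gt (α := V)) _
        fun v hv => lt_of_le_of_ne (hR _ _) hv.symm
  choose par hpar using hpar
  -- Only one parity class moves; its images under `g` that differ from the vertex lie in the other
  -- class, which is fixed, so these images are star centres.
  let h : (Fin k × Bool) × Bool → V → V := fun i v => if par i.1 v = i.2 then g i.1 v else v
  have key : ∀ j v, g j v ≠ v → ∃ i w, s(v, g j v) = s(w, h i w) ∧ h i (h i w) = h i w := by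
    intro j v hv
    refine ⟨(j, par j v), v, ?_⟩
    simp [h, hpar j v hv]
  have hcard : Fintype.card ((Fin k × Bool) × Bool) = 4 * k := by
    simp; ring
  rw [← hcard]
  refine unionPageNumber_le_card_stars G h fun e he => ?_
  have main : ∀ u v, u < v → s(u, v) ∈ G.edgeSet →
      ∃ i w, s(u, v) = s(w, h i w) ∧ h i (h i w) = h i w := by
    intro u v huv he
    have he' := he
    rw [← L.sUnion_eq] at he'
    obtain ⟨P, hP, hePe⟩ := he'
    rcases harc P hP u v huv hePe with h1 | h1
    · obtain ⟨j, hj⟩ := hpage u ⟨hP, _, hePe, Sym2.mem_mk_left u v⟩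
      have hg : g (j, true) u = v := by simp [g, hj, h1]
      have := key (j, true) u (by rw [hg]; exact huv.ne')
      rwa [hg] at this
    · obtain ⟨j, hj⟩ := hpage v ⟨hP, _, hePe, Sym2.mem_mk_right u v⟩
      have hg : g (j, false) v = u := by simp [g, hj, h1]
      have := key (j, false) v (by rw [hg]; exact huv.ne)
      rwa [hg, Sym2.eq_swap] at this
  induction e with | _ u v =>
  have hne : u ≠ v := G.ne_of_adj he
  rcases lt_or_gt_of_ne hne with hlt | hlt
  · exact main u v hlt he
  · rw [Sym2.eq_swap] at he ⊢
    exact main v u hlt he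


/-! ### Blocks of the spine -/

/-- Cutting the spine into `s` blocks of `B` consecutive vertices, the edges of a graph with a
`p`-page book embedding join few pairs of blocks. -/
theorem exists_blocks {V : Type*} [Fintype V] (G : SimpleGraph V) {s B : ℕ}
    (hcard : Fintype.card V = s * B) :
    ∃ (e : V ≃ Fin s × Fin B) (Q : Finset (Fin s × Fin s)),
      Q.card ≤ (4 * pageNumber G + 1) * s ∧ ∀ u v, G.Adj u v → ((e u).1, (e v).1) ∈ Q := by
  classical
  obtain ⟨L, hbook, hpages⟩ := exists_isBook_pages_encard G
  set p := pageNumber G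
  let := L.spine
  have hfin : L.pages.Finite := Set.finite_of_encard_eq_coe hpages
  have hp : hfin.toFinset.card = p := by
    rw [hfin.encard_eq_coe_toFinset_card] at hpages
    exact_mod_cast hpages
  let o : V ≃o Fin (s * B) := (Fintype.orderIsoFinOfCardEq V hcard).symm
  let e : V ≃ Fin s × Fin B := o.toEquiv.trans finProdFinEquiv.symm
  -- Hence crossing arcs between blocks would come from crossing edges.
  have hmono : ∀ u v, (e u).1 < (e v).1 → u < v := by
    intro u v h
    by_contra! hvu
    refine absurd h (not_lt.2 ?_)
    have h1 : o v ≤ o u := o.monotone hvu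
    change ((o v : ℕ) / B) ≤ ((o u : ℕ) / B)
    exact Nat.div_le_div_right h1
  have harcs : ∀ P : Set (Sym2 V), ∃ R L' : Fin s → Fin s,
      P ∈ L.pages → ∀ u v, (e u).1 < (e v).1 → s(u, v) ∈ P →
        R (e u).1 = (e v).1 ∨ L' (e v).1 = (e u).1 := by
    intro P
    by_cases hP : P ∈ L.pages
    · obtain ⟨R, L', -, -, h⟩ := exists_longest_arcs
        (fun i j : Fin s => i < j ∧ ∃ u v, (e u).1 = i ∧ (e v).1 = j ∧ s(u, v) ∈ P)
        (fun i j h => h.1) (by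
          rintro i j i' j' ⟨-, u, v, rfl, rfl, huv⟩ ⟨-, x, y, rfl, rfl, hxy⟩ h1 h2 h3
          exact hbook P hP u x v y (hmono _ _ h1) (hmono _ _ h2) (hmono _ _ h3) huv hxy)
      exact ⟨R, L', fun _ u v huv h' => h _ _ ⟨huv, u, v, rfl, rfl, h'⟩⟩
    · exact ⟨id, id, fun h => (hP h).elim⟩
  choose R L' harc using harcs
  let I : Finset (Set (Sym2 V) × Fin s) := hfin.toFinset ×ˢ Finset.univ
  have hI : I.card = p * s := by
    rw [Finset.card_product, hp, Finset.card_fin]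
  -- The diagonal gives `s` pairs; each page gives `R` and `L'` arcs in both orientations, at most
  -- `4 * s` pairs.
  let Q : Finset (Fin s × Fin s) :=
    ((((Finset.univ : Finset (Fin s)).image fun i => (i, i)) ∪
      I.image fun x => (x.2, R x.1 x.2)) ∪ (I.image fun x => (R x.1 x.2, x.2))) ∪
      ((I.image fun x => (x.2, L' x.1 x.2)) ∪ (I.image fun x => (L' x.1 x.2, x.2)))
  refine ⟨e, Q, ?_, ?_⟩
  · have h0 : ((Finset.univ : Finset (Fin s)).image fun i => (i, i)).card ≤ s :=
      Finset.card_image_le.trans (by simp)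
    have h1 : ∀ f : Set (Sym2 V) × Fin s → Fin s × Fin s, (I.image f).card ≤ p * s :=
      fun f => hI ▸ Finset.card_image_le
    refine (Finset.card_union_le _ _).trans ?_
    refine (Nat.add_le_add ((Finset.card_union_le _ _).trans (Nat.add_le_add
      ((Finset.card_union_le _ _).trans (Nat.add_le_add h0 (h1 _))) (h1 _)))
      ((Finset.card_union_le _ _).trans (Nat.add_le_add (h1 _) (h1 _)))).trans ?_
    apply le_of_eq
    ring
  · have hI' : ∀ P ∈ L.pages, ∀ i, (P, i) ∈ I := fun P hP i => by simp [I, hP]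
    have main : ∀ u v, (e u).1 < (e v).1 → G.Adj u v →
        ((e u).1, (e v).1) ∈ Q ∧ ((e v).1, (e u).1) ∈ Q := by
      intro u v huv hadj
      rw [← SimpleGraph.mem_edgeSet, ← L.sUnion_eq] at hadj
      obtain ⟨P, hP, he⟩ := hadj
      simp only [Q, Finset.mem_union, Finset.mem_image]
      rcases harc P hP u v huv he with h | h
      · exact ⟨Or.inl (Or.inl (Or.inr ⟨_, hI' P hP (e u).1, by simp [h]⟩)),
          Or.inl (Or.inr ⟨_, hI' P hP (e u).1, by simp [h]⟩)⟩
      · exact ⟨Or.inr (Or.inr ⟨_, hI' P hP (e v).1, by simp [h]⟩),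
          Or.inr (Or.inl ⟨_, hI' P hP (e v).1, by simp [h]⟩)⟩
    intro u v hadj
    rcases lt_trichotomy (e u).1 (e v).1 with h | h | h
    · exact (main u v h hadj).1
    · rw [h]
      simp only [Q, Finset.mem_union, Finset.mem_image]
      exact Or.inl (Or.inl (Or.inl ⟨_, Finset.mem_univ _, rfl⟩))
    · exact (main v u h hadj.symm).2

theorem pageNumber_pos {V : Type*} [Finite V] {G : SimpleGraph V} {u v : V} (h : G.Adj u v) :
    0 < pageNumber G := by
  obtain ⟨L, -, hpages⟩ := exists_isBook_pages_encard G
  by_contra h0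
  rw [Nat.eq_zero_of_not_pos h0, Nat.cast_zero, Set.encard_eq_zero] at hpages
  rw [← SimpleGraph.mem_edgeSet, ← L.sUnion_eq, hpages, Set.sUnion_empty] at h
  exact h

/-! ### Lifts of the complete bipartite graph -/

/-- The vertices of an `m`-fold lift of `K_{k,k}`. -/
abbrev LiftVertex (k m : ℕ) : Type := (Fin k × Fin m) ⊕ (Fin k × Fin m)

/-- The `m`-fold lift of the complete bipartite graph `K_{k,k}` given by a permutation for each of
its edges. -/
def lift {k m : ℕ} (σ : Fin k × Fin k → Equiv.Perm (Fin m)) : SimpleGraph (LiftVertex k m) where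
  Adj x y := (∃ c d a, x = Sum.inl (c, a) ∧ y = Sum.inr (d, σ (c, d) a)) ∨
    ∃ c d a, y = Sum.inl (c, a) ∧ x = Sum.inr (d, σ (c, d) a)
  symm := ⟨fun _ _ h => h.symm⟩
  loopless := ⟨by
    rintro x (⟨c, d, a, h1, h2⟩ | ⟨c, d, a, h1, h2⟩) <;> exact absurd (h1.symm.trans h2) (by simp)⟩

theorem lift_adj {k m : ℕ} (σ : Fin k × Fin k → Equiv.Perm (Fin m)) (c d : Fin k) (a : Fin m) :
    (lift σ).Adj (Sum.inl (c, a)) (Sum.inr (d, σ (c, d) a)) :=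
  Or.inl ⟨c, d, a, rfl, rfl⟩

theorem natCard_lift_neighborSet {k m : ℕ} (σ : Fin k × Fin k → Equiv.Perm (Fin m))
    (x : LiftVertex k m) : Nat.card ((lift σ).neighborSet x) = k := by
  have key : ∃ f : Fin k → LiftVertex k m, Function.Injective f ∧
      (lift σ).neighborSet x = Set.range f := by
    rcases x with ⟨c, a⟩ | ⟨d, b⟩
    · refine ⟨fun d => Sum.inr (d, σ (c, d) a),
        fun d d' h => (Prod.mk.inj (Sum.inr.inj h)).1, ?_⟩
      ext y
      constructor
      · rintro (⟨c', d, a', h1, rfl⟩ | ⟨c', d, a', rfl, h2⟩)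
        · obtain ⟨rfl, rfl⟩ : c = c' ∧ a = a' := by simpa using h1
          exact ⟨d, rfl⟩
        · simp at h2
      · rintro ⟨d, rfl⟩
        exact lift_adj σ c d a
    · refine ⟨fun c => Sum.inl (c, (σ (c, d)).symm b),
        fun c c' h => (Prod.mk.inj (Sum.inl.inj h)).1, ?_⟩
      ext y
      constructor
      · rintro (⟨c', d, a', h1, rfl⟩ | ⟨c', d', a', rfl, h2⟩)
        · simp at h1
        · obtain ⟨rfl, rfl⟩ : d = d' ∧ b = σ (c', d') a' := by simpa using h2
          exact ⟨c', by simp⟩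
      · rintro ⟨c, rfl⟩
        have := lift_adj σ c d ((σ (c, d)).symm b)
        rw [Equiv.apply_symm_apply] at this
        exact this.symm
  obtain ⟨f, hf, heq⟩ := key
  rw [heq, Nat.card_range_of_injective hf, Nat.card_fin]

theorem isRegularOfDegree_comap_lift {V : Type*} {k m : ℕ} (φ : V ≃ LiftVertex k m)
    (σ : Fin k × Fin k → Equiv.Perm (Fin m)) [((lift σ).comap φ).LocallyFinite] :
    ((lift σ).comap φ).IsRegularOfDegree k := by
  intro v
  rw [← SimpleGraph.card_neighborSet_eq_degree, ← Nat.card_eq_fintype_card,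
    Nat.card_congr ((SimpleGraph.Iso.comap φ (lift σ)).mapNeighborSet v)]
  exact natCard_lift_neighborSet σ _

theorem unionPageNumber_comap_lift_le {V : Type*} {k m : ℕ} (φ : V ≃ LiftVertex k m)
    (σ : Fin k × Fin k → Equiv.Perm (Fin m)) : unionPageNumber ((lift σ).comap φ) ≤ k := by
  -- For fixed `d`, the edges into the fibre over the right vertex `d` form stars centred there.
  let f : Fin k → LiftVertex k m → LiftVertex k m := fun d =>
    Sum.elim (fun x => Sum.inr (d, σ (x.1, d) x.2)) Sum.inr
  have := unionPageNumber_le_card_stars ((lift σ).comap φ)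
    (fun d v => φ.symm (f d (φ v))) (by
      intro e he
      have main : ∀ u v : V, (∃ c d a, φ u = Sum.inl (c, a) ∧ φ v = Sum.inr (d, σ (c, d) a)) →
          ∃ i w, s(u, v) = s(w, φ.symm (f i (φ w))) ∧
            φ.symm (f i (φ (φ.symm (f i (φ w))))) = φ.symm (f i (φ w)) := by
        rintro u v ⟨c, d, a, hu, hv⟩
        refine ⟨d, u, ?_, ?_⟩
        · rw [hu, ← φ.symm_apply_apply v, hv]
          simp [f]
        · rw [hu]
          simp [f]
      induction e with | _ u v =>
      rcases he with h | h
      · exact main u v h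
      · rw [Sym2.eq_swap]
        exact main v u h)
  simpa using this

/-! ### Counting lifts -/

theorem prod_le_mean_pow {ι : Type*} (s : Finset ι) (z : ι → ℝ) (hz : ∀ i ∈ s, 0 ≤ z i) :
    ∏ i ∈ s, z i ≤ ((∑ i ∈ s, z i) / s.card) ^ s.card := by
  rcases s.eq_empty_or_nonempty with rfl | hs
  · simp
  have hpos : 0 < s.card := hs.card_pos
  have h := Real.geom_mean_le_arith_mean s (fun _ => 1) z (by simp) (by simpa using hpos) hz
  simp only [Real.rpow_one, one_mul, Finset.sum_const, nsmul_eq_mul, mul_one] at h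
  have h0 : 0 ≤ ∏ i ∈ s, z i := Finset.prod_nonneg hz
  calc ∏ i ∈ s, z i = ((∏ i ∈ s, z i) ^ ((s.card : ℝ)⁻¹)) ^ s.card :=
        (Real.rpow_inv_natCast_pow h0 hpos.ne').symm
    _ ≤ _ := pow_le_pow_left₀ (Real.rpow_nonneg h0 _) h _

/-- The number of lifts all of whose edges lie in a given set of pairs of blocks. -/
theorem card_lifts_in_blocks_le {k m s B : ℕ} (e : LiftVertex k m ≃ Fin s × Fin B)
    (Q : Finset (Fin s × Fin s)) (S : Finset (Fin k × Fin k → Equiv.Perm (Fin m)))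
    (hS : ∀ σ ∈ S, ∀ c d a,
      ((e (Sum.inl (c, a))).1, (e (Sum.inr (d, σ (c, d) a))).1) ∈ Q) :
    (S.card : ℝ) ≤
      ((Q.card * B ^ 2 : ℝ) / (k ^ 2 * m)) ^ (k ^ 2 * m) := by
  -- `D` holds the admissible values of each permutation at each point. Bijectivity is ignored in
  -- the product bound; the sizes sum to at most the number of vertex pairs lying over `Q`.
  let D : (Fin k × Fin k) × Fin m → Finset (Fin m) := fun x =>
    Finset.univ.filter fun b => ((e (Sum.inl (x.1.1, x.2))).1, (e (Sum.inr (x.1.2, b))).1) ∈ Q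
  have h1 : S.card ≤ ∏ x, (D x).card := by
    rw [← Fintype.card_piFinset]
    refine Finset.card_le_card_of_injOn (fun σ x => σ x.1 x.2) ?_ ?_
    · intro σ hσ
      simp only [Finset.mem_coe, Fintype.mem_piFinset, D, Finset.mem_filter, Finset.mem_univ,
        true_and]
      exact fun x => hS σ hσ _ _ _
    · intro σ _ τ _ h
      funext x
      ext a
      exact congrArg Fin.val (congrFun h (x, a))
  have h2 : ∑ x, (D x).card ≤ Q.card * B ^ 2 := by
    rw [← Finset.card_sigma]
    have : (Q ×ˢ (Finset.univ : Finset (Fin B × Fin B))).card = Q.card * B ^ 2 := by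
      simp [Finset.card_product, sq]
    rw [← this]
    refine Finset.card_le_card_of_injOn
      (fun y => (((e (Sum.inl (y.1.1.1, y.1.2))).1, (e (Sum.inr (y.1.1.2, y.2))).1),
        ((e (Sum.inl (y.1.1.1, y.1.2))).2, (e (Sum.inr (y.1.1.2, y.2))).2))) ?_ ?_
    · rintro ⟨x, b⟩ hx
      simpa [D] using hx
    · rintro ⟨⟨⟨c, d⟩, a⟩, b⟩ _ ⟨⟨⟨c', d'⟩, a'⟩, b'⟩ _ h
      obtain ⟨h12, h34⟩ := Prod.mk.inj h
      obtain ⟨h1, h2⟩ := Prod.mk.inj h12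
      obtain ⟨h3, h4⟩ := Prod.mk.inj h34
      obtain ⟨rfl, rfl⟩ := Prod.mk.inj (Sum.inl.inj (e.injective (Prod.ext h1 h3)))
      obtain ⟨rfl, rfl⟩ := Prod.mk.inj (Sum.inr.inj (e.injective (Prod.ext h2 h4)))
      rfl
  clear_value D
  have hN : (Finset.univ : Finset ((Fin k × Fin k) × Fin m)).card = k ^ 2 * m := by
    simp [sq]
  have h3 := prod_le_mean_pow (Finset.univ : Finset ((Fin k × Fin k) × Fin m))
    (fun x => ((D x).card : ℝ)) (fun _ _ => Nat.cast_nonneg _)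
  rw [hN] at h3
  calc _ ≤ ∏ x, ((D x).card : ℝ) := by exact_mod_cast h1
    _ ≤ _ := h3
    _ ≤ _ := pow_le_pow_left₀ (by positivity) ?_ _
  have h4 : ∑ x, ((D x).card : ℝ) ≤ Q.card * B ^ 2 := by exact_mod_cast h2
  rw [Nat.cast_mul, Nat.cast_pow]
  exact div_le_div_of_nonneg_right h4 (by positivity)

/-- Each lift determines a block assignment and a set `Q`; the first two factors count these data,
and the last bounds the lifts sharing them. -/
theorem factorial_pow_le_of_pageNumber_le {V : Type*} [Fintype V] {k m s B p : ℕ}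
    (φ : V ≃ LiftVertex k m) (hcard : Fintype.card V = s * B)
    (hp : ∀ σ : Fin k × Fin k → Equiv.Perm (Fin m), pageNumber ((lift σ).comap φ) ≤ p) :
    ((m.factorial : ℝ) ^ k ^ 2) ≤ (s : ℝ) ^ (2 * k * m) * 2 ^ (s ^ 2) *
      ((((4 * p + 1) * s) * B ^ 2 : ℝ) / (k ^ 2 * m)) ^ (k ^ 2 * m) := by
  classical
  choose e Q hQ hadj using fun σ : Fin k × Fin k → Equiv.Perm (Fin m) =>
    exists_blocks ((lift σ).comap φ) hcard
  let f : (Fin k × Fin k → Equiv.Perm (Fin m)) →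
      (LiftVertex k m → Fin s) × Finset (Fin s × Fin s) :=
    fun σ => (fun x => (e σ (φ.symm x)).1, Q σ)
  set M : ℝ := ((((4 * p + 1) * s) * B ^ 2 : ℝ) / (k ^ 2 * m)) ^ (k ^ 2 * m)
  have hM : 0 ≤ M := by positivity
  have hfib : ∀ y, ((Finset.univ.filter fun σ => f σ = y).card : ℝ) ≤ M := by
    intro y
    rcases (Finset.univ.filter fun σ => f σ = y).eq_empty_or_nonempty with h | ⟨τ, hτ⟩
    · rw [h]
      simpa using hM
    · have hτ' : f τ = y := by simpa using hτ
      have hsub : ∀ σ ∈ Finset.univ.filter fun σ => f σ = y, ∀ c d a,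
          (((φ.symm.trans (e τ)) (Sum.inl (c, a))).1,
            ((φ.symm.trans (e τ)) (Sum.inr (d, σ (c, d) a))).1) ∈ Q τ := by
        intro σ hσ c d a
        have hσ' : f σ = f τ := by rw [hτ']; simpa using hσ
        have h1 : ∀ x, (e σ (φ.symm x)).1 = (e τ (φ.symm x)).1 :=
          congrFun (congrArg Prod.fst hσ')
        have h2 : Q σ = Q τ := congrArg Prod.snd hσ'
        simp only [Equiv.trans_apply]
        rw [← h1, ← h1, ← h2]
        apply hadj
        simpa using lift_adj σ c d a
      calc _ ≤ _ := card_lifts_in_blocks_le _ _ _ hsub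
        _ ≤ M := by
          have : ((Q τ).card : ℝ) ≤ (4 * p + 1) * s := by
            have h3 : (Q τ).card ≤ (4 * p + 1) * s := by
              refine (hQ τ).trans ?_
              gcongr
              exact hp τ
            exact_mod_cast h3
          change _ ≤ ((((4 * p + 1) * s) * B ^ 2 : ℝ) / (k ^ 2 * m)) ^ (k ^ 2 * m)
          gcongr
  have hsum : Fintype.card (Fin k × Fin k → Equiv.Perm (Fin m)) =
      ∑ y, (Finset.univ.filter fun σ => f σ = y).card := by
    rw [← Finset.card_univ]
    exact Finset.card_eq_sum_card_fiberwise fun _ _ => Finset.mem_coe.2 (Finset.mem_univ _)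
  have hleft : Fintype.card (Fin k × Fin k → Equiv.Perm (Fin m)) = m.factorial ^ k ^ 2 := by
    simp [Fintype.card_perm, sq]
  have hright : Fintype.card ((LiftVertex k m → Fin s) × Finset (Fin s × Fin s)) =
      s ^ (2 * k * m) * 2 ^ s ^ 2 := by
    rw [Fintype.card_prod, Fintype.card_fun, Fintype.card_sum, Fintype.card_finset]
    simp only [Fintype.card_prod, Fintype.card_fin]
    ring
  calc ((m.factorial : ℝ) ^ k ^ 2) = ∑ y, ((Finset.univ.filter fun σ => f σ = y).card : ℝ) := by
        rw [← Nat.cast_pow, ← hleft, hsum]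
        push_cast
        rfl
    _ ≤ ∑ _y : (LiftVertex k m → Fin s) × Finset (Fin s × Fin s), M :=
        Finset.sum_le_sum fun y _ => hfib y
    _ = _ := by
        rw [Finset.sum_const, Finset.card_univ, hright, nsmul_eq_mul]
        push_cast
        rfl

/-! ### The numerical estimate -/

/-- Here `m = 2t²`, `s = 2kt`, `B = 2t`, so `n = sB = 4kt²` and `s² = 2k²m`: the factor `2 ^ (s ^
2)` costs only 4 per edge of the lift. -/
theorem page_bound_of_factorial_pow_le {k t p : ℕ} (hk : 0 < k) (ht : 0 < t) (hp : 0 < p)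
    (h : (((2 * t ^ 2).factorial : ℝ) ^ k ^ 2) ≤
      ((2 * k * t : ℕ) : ℝ) ^ (2 * k * (2 * t ^ 2)) * 2 ^ ((2 * k * t) ^ 2) *
      ((((4 * p + 1) * (2 * k * t : ℕ)) * (2 * t : ℕ) ^ 2 : ℝ) / (k ^ 2 * (2 * t ^ 2 : ℕ))) ^
        (k ^ 2 * (2 * t ^ 2))) :
    (1 / 480 : ℝ) * (Real.sqrt k * ((4 * k * t ^ 2 : ℕ) : ℝ) ^ ((1 : ℝ) / 2 - 1 / k)) ≤ p := by
  have hk' : (0 : ℝ) < k := by exact_mod_cast hk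
  have ht' : (0 : ℝ) < t := by exact_mod_cast ht
  have hp' : (1 : ℝ) ≤ p := by exact_mod_cast hp
  set m := 2 * t ^ 2 with hm
  have hm0 : 0 < m := by positivity
  have hmR : (m : ℝ) = 2 * t ^ 2 := by rw [hm]; push_cast; ring
  have hfact : (m : ℝ) ^ m ≤ 3 ^ m * m.factorial := by
    have h1 := Real.pow_div_factorial_le_exp (m : ℝ) (Nat.cast_nonneg m) m
    rw [div_le_iff₀ (by positivity)] at h1
    refine h1.trans ?_
    gcongr
    rw [← mul_one (m : ℝ), Real.exp_nat_mul]
    exact pow_le_pow_left₀ (Real.exp_pos _).le Real.exp_one_lt_three.le _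
  have hX : ((((4 * p + 1) * (2 * k * t : ℕ)) * (2 * t : ℕ) ^ 2 : ℝ) / (k ^ 2 * (m : ℕ))) ≤
      20 * p * t / k := by
    rw [div_le_div_iff₀ (by positivity) hk', hmR]
    push_cast
    have : (4 * (p : ℝ) + 1) ≤ 5 * p := by linarith
    calc (4 * (p : ℝ) + 1) * (2 * k * t) * (2 * t) ^ 2 * k ≤ 5 * p * (2 * k * t) * (2 * t) ^ 2 * k := by
          gcongr
      _ = _ := by ring
  have hkm : k * m ≠ 0 := by positivity
  -- This is the `km`-th root of the count; 240 = 3 · 4 · 20, from `m! ≥ (m/3) ^ m`, `2 ^ (s ^ 2)`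
  -- and `hX`.
  have hroot : (m : ℝ) ^ k ≤ (240 * p * t / k) ^ k * (2 * k * t) ^ 2 := by
    refine le_of_pow_le_pow_left₀ hkm (by positivity) ?_
    calc ((m : ℝ) ^ k) ^ (k * m) = ((m : ℝ) ^ m) ^ (k ^ 2) := by
          rw [← pow_mul, ← pow_mul]; congr 1; ring
      _ ≤ (3 ^ m * m.factorial) ^ (k ^ 2) := by gcongr
      _ = (3 ^ m) ^ (k ^ 2) * (m.factorial : ℝ) ^ (k ^ 2) := mul_pow _ _ _
      _ ≤ (3 ^ m) ^ (k ^ 2) * (((2 * k * t : ℕ) : ℝ) ^ (2 * k * m) * 2 ^ ((2 * k * t) ^ 2) *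
          (20 * p * t / k) ^ (k ^ 2 * m)) := by
          gcongr
          refine h.trans ?_
          gcongr
      _ = (3 * 4 * (20 * p * t / k)) ^ (k ^ 2 * m) * ((2 * k * t) ^ 2) ^ (k * m) := by
          have h4 : (2 : ℝ) ^ ((2 * k * t) ^ 2) = 4 ^ (k ^ 2 * m) := by
            rw [show (4 : ℝ) = 2 ^ 2 by norm_num, ← pow_mul]
            congr 1
            rw [hm]; ring
          rw [h4, mul_pow, mul_pow, ← pow_mul, ← pow_mul]
          push_cast
          rw [show m * k ^ 2 = k ^ 2 * m by ring, show 2 * k * m = 2 * (k * m) by ring]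
          ring
      _ = _ := by
          rw [mul_pow _ ((2 * k * t : ℝ) ^ 2), ← pow_mul _ k,
            show k * (k * m) = k ^ 2 * m by ring]
          congr 2
          ring
  have hdiv : (k * t / (120 * p) : ℝ) ^ k ≤ (2 * k * t) ^ 2 := by
    have hpos : (0 : ℝ) < (240 * p * t / k) ^ k := by positivity
    have : (k * t / (120 * p) : ℝ) ^ k = (m : ℝ) ^ k / (240 * p * t / k) ^ k := by
      rw [← div_pow, hmR]
      congr 1
      field_simp
      ring
    rw [this, div_le_iff₀ hpos]
    linarith
  set n : ℝ := ((4 * k * t ^ 2 : ℕ) : ℝ) with hn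
  have hnR : n = 4 * k * t ^ 2 := by rw [hn]; push_cast; ring
  have hn0 : 0 < n := by rw [hnR]; positivity
  have hle : (k * t / (120 * p) : ℝ) ≤ 2 * n ^ ((1 : ℝ) / k) := by
    refine le_of_pow_le_pow_left₀ hk.ne' (by positivity) (hdiv.trans ?_)
    rw [mul_pow 2, one_div, Real.rpow_inv_natCast_pow hn0.le hk.ne', hnR]
    -- Since `(2kt)² = kn`, this lets the `k`-th root of `k` be absorbed into the factor 2.
    have h2 : (k : ℝ) ≤ 2 ^ k := by exact_mod_cast Nat.lt_two_pow_self.le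
    calc (2 * k * t : ℝ) ^ 2 = k * (4 * k * t ^ 2) := by ring
      _ ≤ _ := by gcongr
  have hmain : Real.sqrt k * n ^ ((1 : ℝ) / 2 - 1 / k) = 2 * k * t / n ^ ((1 : ℝ) / k) := by
    rw [Real.rpow_sub hn0, ← mul_div_assoc, ← Real.sqrt_eq_rpow, ← Real.sqrt_mul hk'.le]
    congr 1
    rw [hnR, show (k : ℝ) * (4 * k * t ^ 2) = (2 * k * t) ^ 2 by ring]
    exact Real.sqrt_sq (by positivity)
  have hn1 : 0 < n ^ ((1 : ℝ) / k) := Real.rpow_pos_of_pos hn0 _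
  rw [hmain]
  rw [div_le_iff₀ (by positivity)] at hle
  rw [← mul_div_assoc, div_le_iff₀ hn1]
  linarith

theorem exists_lift_le_pageNumber {k t : ℕ} (hk : 0 < k) (ht : 0 < t)
    (φ : Fin (4 * k * t ^ 2) ≃ LiftVertex k (2 * t ^ 2)) :
    ∃ σ : Fin k × Fin k → Equiv.Perm (Fin (2 * t ^ 2)),
      (1 / 480 : ℝ) * (Real.sqrt k * ((4 * k * t ^ 2 : ℕ) : ℝ) ^ ((1 : ℝ) / 2 - 1 / k)) ≤
        pageNumber ((lift σ).comap φ) := by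
  -- The maximal page number bounds all lifts at once, so the count applies to it.
  obtain ⟨σ, hσ⟩ := Finite.exists_max
    fun σ : Fin k × Fin k → Equiv.Perm (Fin (2 * t ^ 2)) => pageNumber ((lift σ).comap φ)
  refine ⟨σ, page_bound_of_factorial_pow_le hk ht ?_ (factorial_pow_le_of_pageNumber_le φ
    (by rw [Fintype.card_fin]; ring) hσ)⟩
  -- An edge exists, so `p ≥ 1`, which is needed to replace `4p + 1` by `5p`.
  let c : Fin k := ⟨0, hk⟩
  let a : Fin (2 * t ^ 2) := ⟨0, by positivity⟩
  refine pageNumber_pos (u := φ.symm (Sum.inl (c, a))) (v := φ.symm (Sum.inr (c, σ (c, c) a))) ?_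
  simpa using lift_adj σ c c a

end BookEmbedding

theorem theorem1 :
    (∃ c : ℝ, 0 < c ∧ ∀ k : ℕ, 3 ≤ k →
      {n : ℕ | ∃ (G : SimpleGraph (Fin n)) (_ : G.LocallyFinite),
        G.IsRegularOfDegree k ∧
        BookEmbedding.localPageNumber G ≤ BookEmbedding.unionPageNumber G ∧
        BookEmbedding.unionPageNumber G ≤ k + 2 ∧
        c * (Real.sqrt (k : ℝ) * (n : ℝ) ^ ((1 : ℝ) / 2 - 1 / (k : ℝ))) ≤
          (BookEmbedding.pageNumber G : ℝ)}.Infinite) ∧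
    (∀ (V : Type*) [Finite V] (G : SimpleGraph V),
      BookEmbedding.unionPageNumber G ≤ 4 * BookEmbedding.localPageNumber G + 2) := by
  refine ⟨⟨1 / 480, by norm_num, fun k hk => ?_⟩, fun V _ G =>
    (BookEmbedding.unionPageNumber_le_four_mul G).trans (Nat.le_add_right _ _)⟩
  have hk0 : 0 < k := by omega
  refine Set.infinite_of_injective_forall_mem (f := fun t : ℕ => 4 * k * (t + 1) ^ 2) ?_ ?_
  · intro t t' h
    have h1 : (t + 1) ^ 2 = (t' + 1) ^ 2 := Nat.eq_of_mul_eq_mul_left (by positivity) h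
    exact Nat.succ_injective (Nat.pow_left_injective two_ne_zero h1)
  · intro t
    have φ : Fin (4 * k * (t + 1) ^ 2) ≃ BookEmbedding.LiftVertex k (2 * (t + 1) ^ 2) :=
      Fintype.equivOfCardEq (by simp; ring)
    obtain ⟨σ, hσ⟩ := BookEmbedding.exists_lift_le_pageNumber hk0 t.succ_pos φ
    let inst : ((BookEmbedding.lift σ).comap φ).LocallyFinite := fun _ => Fintype.ofFinite _
    refine ⟨(BookEmbedding.lift σ).comap φ, inst,
      BookEmbedding.isRegularOfDegree_comap_lift φ σ,
      BookEmbedding.localPageNumber_le_unionPageNumber _,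
      (BookEmbedding.unionPageNumber_comap_lift_le φ σ).trans (Nat.le_add_right _ _), hσ⟩
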